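/- **Setting.** Let $1\le k\le d$. Let $\mathcal M\subset\mathbb R^n$ be a smooth embedded $d$-dimensional submanifold of positive reach whose normal curvatures are at most $\kappa\ge 0$ (that is, $\|\mathrm{II}(u,u)\|\le\kappa\|u\|^2$), let $0<\rho<\mathrm{reach}(\mathcal M)$, let $\mathcal T_\rho=\{x:\mathrm{dist}(x,\mathcal M)\le\rho\}$, and let $\pi:\mathcal T_\rho\to\mathcal M$ be the nearest-point projection. Let $\Phi:\mathbb R^n\to\mathcal T_\rho$ be a backward probability-flow map: for some $T>0$, an integrable schedule $\beta\ge0$ on $[0,T]$ and a score $s(x,t)$, $\Phi(z)=x(0)$, where $x$ solves $\dot x=-\tfrac12\beta(t)x-\tfrac12\beta(t)s(x,t)$ on $[0,T]$ with $x(T)=z$ (a solution exists for every $z$, and all solutions have the same value at $0$). Put $\Pi=\pi\circ\Phi$. Fix $z$ and suppose that, on the ball of radius $r>0$ around $z$, $\Phi$ is $C^3$ with $\|D^2\Phi\|,\|D^3\Phi\|\le B$. For perturbations $\xi_1,\dots,\xi_k\in\mathbb R^n$ and $\sigma>0$ let $\Xi=[\xi_1,\dots,\xi_k]$, $\Delta_i=\Phi(z+\sigma\xi_i)-\Phi(z)$,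 $S_k=\mathrm{span}\{\Delta_1,\dots,\Delta_k\}$, $T=T_{\Pi(z)}\mathcal M$ and $s_{\min}=\sigma_{\min}(D\Pi(z)\Xi)$ (the $k$-th singular value). $P_T^\perp$ and $P_{S_k}$ are the orthogonal projectors onto $T^\perp$ and $S_k$, and $\|\cdot\|$ is the spectral norm. Suppose that $s_{\min}\ge s_0>0$, that $$\|P_T^\perp D\Phi(z)\|\le L_\perp\rho,\qquad \|P_T^\perp R\|\le C_{\rm curv}\,\kappa\,\sigma^2\|\Xi\|^2,$$ where $R=[R_1,\dots,R_k]$, $R_i=\tfrac{\sigma^2}{2}D^2\Phi(z)[\xi_i,\xi_i]$, and that $\mathrm{reach}(\mathcal M)\ge\tau>0$. **Theorem.** 1. There is a constant $C_3\ge 0$, depending only on $n,d,k,B$, such that for all $\xi_1,\dots,\xi_k$ and all $\tau,r,s_0,\varepsilon>0$ there are $\sigma_0,\rho_0>0$ such that, for all $\mathcal M,\Phi,z,\kappa,L_\perp,C_{\rm curv}$ as above and all $\sigma\le\sigma_0$, $\rho\le\rho_0$, $$\|P_T^\perp P_{S_k}\|\le(1+\varepsilon)\left(\frac{L_\perp\rho\|\Xi\|}{s_{\min}}+\frac{C_{\rm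 curv}\kappa\sigma\|\Xi\|^2}{s_{\min}}\right)+\frac{C_3\sigma^2\|\Xi\|^3}{s_{\min}}.$$ Moreover, with the same $C_3$, for all $\xi_1,\dots,\xi_k,\tau,r,s_0$ there is $\sigma_0>0$ such that for every fixed $\sigma\in(0,\sigma_0]$, all $L_\perp,C_{\rm curv}$ and every $\eta>0$ there is $\delta>0$ with $\|P_T^\perp P_{S_k}\|\le C_3\sigma^2\|\Xi\|^3/s_{\min}+\eta$ whenever $\rho,\kappa\le\delta$. 2. For all $\xi_1,\dots,\xi_k$, all $\tau,r,s_0,\Lambda>0$ and all $\kappa,L_\perp,C_{\rm curv}$ there are $C_3\ge0$ and $\sigma_0,\rho_0>0$ such that, for all $\mathcal M,\Phi,z$ as above and all $\sigma\le\sigma_0$, $\rho\le\min(\rho_0,\Lambda\sigma)$, $$\|P_T^\perp P_{S_k}\|\le\frac{L_\perp\rho\|\Xi\|}{s_{\min}}+\frac{C_{\rm curv}\kappa\sigma\|\Xi\|^2}{s_{\min}}+\frac{C_3\sigma^2\|\Xi\|^3}{s_{\min}}.$$ 3. For fixed $\sigma$, $\Xi$, $s_{\min}$, $L_\perp$, $C_{\rm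 curv}$, the first two terms $L_\perp\rho\|\Xi\|/s_{\min}$ and $C_{\rm curv}\kappa\sigma\|\Xi\|^2/s_{\min}$ tend to $0$ as $\rho\to0$ and $\kappa\to0$. -/

import Mathlib

open Set Filter Topology MeasureTheory
open scoped ENNReal ContDiff

noncomputable section

/-- `M ⊆ ℝⁿ` is a smooth embedded `d`-dimensional submanifold: around each of its points there is a
smooth chart of the ambient space which flattens `M` to a `d`-dimensional linear subspace. -/
def IsSmoothSubmanifold {n : ℕ} (d : ℕ) (M : Set (EuclideanSpace ℝ (Fin n))) : Prop :=
  ∀ p ∈ M, ∃ (e : OpenPartialHomeomorph (EuclideanSpace ℝ (Fin n)) (EuclideanSpace ℝ (Fin n)))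
    (W : Submodule ℝ (EuclideanSpace ℝ (Fin n))),
    p ∈ e.source ∧ ContDiffOn ℝ ∞ e e.source ∧ ContDiffOn ℝ ∞ e.symm e.target ∧
      Module.finrank ℝ W = d ∧ ∀ x ∈ e.source, x ∈ M ↔ e x ∈ W

/-- The tangent space `T_p M`: the linear span of the velocities at `p` of curves in `M`
(for a submanifold the velocities already form a subspace). -/
def tangentSubspace {n : ℕ} (M : Set (EuclideanSpace ℝ (Fin n))) (p : EuclideanSpace ℝ (Fin n)) :
    Submodule ℝ (EuclideanSpace ℝ (Fin n)) :=
  Submodule.span ℝ {v | ∃ γ : ℝ → EuclideanSpace ℝ (Fin n),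
    (∀ t, γ t ∈ M) ∧ γ 0 = p ∧ HasDerivAt γ v 0}

/-- The reach of `M`: the supremum of the radii `r` such that every point at distance less than `r`
from `M` has exactly one nearest point in `M`. -/
def reach {n : ℕ} (M : Set (EuclideanSpace ℝ (Fin n))) : ℝ≥0∞ :=
  sSup {r : ℝ≥0∞ | ∀ x, Metric.infEDist x M < r →
    ∃! y, y ∈ M ∧ edist x y = Metric.infEDist x M}

open Classical in
/-- The nearest-point projection `π` onto `M` (with the value `x` at a point `x` which has no
nearest point in `M`). -/
def nearestPoint {n : ℕ} (M : Set (EuclideanSpace ℝ (Fin n))) (x : EuclideanSpace ℝ (Fin n)) :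
    EuclideanSpace ℝ (Fin n) :=
  if h : ∃ y, y ∈ M ∧ edist x y = Metric.infEDist x M then h.choose else x

/-- All normal curvatures of `M` are at most `κ`: for every `C²` curve in `M`, the normal part of
its acceleration is at most `κ` times its squared speed. Equivalently, the second fundamental form
satisfies `‖II(u, u)‖ ≤ κ ‖u‖²`. -/
def HasCurvatureBound {n : ℕ} (M : Set (EuclideanSpace ℝ (Fin n))) (κ : ℝ) : Prop :=
  0 ≤ κ ∧ ∀ γ : ℝ → EuclideanSpace ℝ (Fin n), ContDiff ℝ 2 γ → (∀ t, γ t ∈ M) →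
    ‖(tangentSubspace M (γ 0))ᗮ.starProjection (deriv (deriv γ) 0)‖ ≤ κ * ‖deriv γ 0‖ ^ 2

/-- The probability-flow vector field `u(x, t) = -½ β(t) x - ½ β(t) s(x, t)` of the
variance-preserving diffusion with noise schedule `β` and score `s`. -/
def pfField {n : ℕ} (β : ℝ → ℝ)
    (s : EuclideanSpace ℝ (Fin n) → ℝ → EuclideanSpace ℝ (Fin n))
    (x : EuclideanSpace ℝ (Fin n)) (t : ℝ) : EuclideanSpace ℝ (Fin n) :=
  -(((1 / 2 : ℝ) * β t) • x) - ((1 / 2 : ℝ) * β t) • s x t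

/-- `X` solves `ẋ = u(x, t)` on `[0, T]` with terminal value `X(T) = z`
(in integrated form, as the schedule is only assumed to be integrable). -/
def IsBackwardSolution {n : ℕ}
    (u : EuclideanSpace ℝ (Fin n) → ℝ → EuclideanSpace ℝ (Fin n)) (T : ℝ)
    (z : EuclideanSpace ℝ (Fin n)) (X : ℝ → EuclideanSpace ℝ (Fin n)) : Prop :=
  ContinuousOn X (Icc 0 T) ∧ IntervalIntegrable (fun t => u (X t) t) volume 0 T ∧
    ∀ t ∈ Icc 0 T, X t = z - ∫ s in t..T, u (X s) s

/-- `Φ` is a backward probability-flow map: for some schedule, score and horizon, every terminal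
value `z` admits a solution of the probability-flow equation on `[0, T]`, and `Φ z` is its
(well-defined) value at time `0`. -/
def IsProbabilityFlowMap {n : ℕ}
    (Φ : EuclideanSpace ℝ (Fin n) → EuclideanSpace ℝ (Fin n)) : Prop :=
  ∃ (β : ℝ → ℝ) (s : EuclideanSpace ℝ (Fin n) → ℝ → EuclideanSpace ℝ (Fin n)) (T : ℝ),
    0 < T ∧ (∀ t, 0 ≤ β t) ∧ IntervalIntegrable β volume 0 T ∧
      ∀ z, (∃ X, IsBackwardSolution (pfField β s) T z X) ∧
        ∀ X, IsBackwardSolution (pfField β s) T z X → X 0 = Φ z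

/-- The `n × k` matrix `[v₁, …, v_k]` with columns `v i`, as an operator `ℝᵏ → ℝⁿ`; its norm is the
spectral norm. -/
def colMatrix {n k : ℕ} (v : Fin k → EuclideanSpace ℝ (Fin n)) :
    EuclideanSpace ℝ (Fin k) →L[ℝ] EuclideanSpace ℝ (Fin n) :=
  ∑ i, (EuclideanSpace.proj i : EuclideanSpace ℝ (Fin k) →L[ℝ] ℝ).smulRight (v i)

/-- The composition `Π = π ∘ Φ`. -/
def footMap {n : ℕ} (M : Set (EuclideanSpace ℝ (Fin n)))
    (Φ : EuclideanSpace ℝ (Fin n) → EuclideanSpace ℝ (Fin n)) :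
    EuclideanSpace ℝ (Fin n) → EuclideanSpace ℝ (Fin n) :=
  fun w => nearestPoint M (Φ w)

/-- `s_min = σ_min(DΠ(z) Ξ)`, the `k`-th (smallest) singular value of the `n × k` matrix
`DΠ(z) Ξ`. Mathlib numbers the singular values from `0`. -/
def tangentSignal {n k : ℕ} (M : Set (EuclideanSpace ℝ (Fin n)))
    (Φ : EuclideanSpace ℝ (Fin n) → EuclideanSpace ℝ (Fin n)) (z : EuclideanSpace ℝ (Fin n))
    (ξ : Fin k → EuclideanSpace ℝ (Fin n)) : ℝ :=
  ((fderiv ℝ (footMap M Φ) z).comp (colMatrix ξ)).toLinearMap.singularValues (k - 1)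

/-- The tangent space `T = T_{Π(z)} M` at the footpoint of `Φ(z)`. -/
def footTangent {n : ℕ} (M : Set (EuclideanSpace ℝ (Fin n)))
    (Φ : EuclideanSpace ℝ (Fin n) → EuclideanSpace ℝ (Fin n)) (z : EuclideanSpace ℝ (Fin n)) :
    Submodule ℝ (EuclideanSpace ℝ (Fin n)) :=
  tangentSubspace M (footMap M Φ z)

/-- The secant span `S_k = span {Δ₁, …, Δ_k}`, `Δ_i = Φ(z + σ ξ_i) - Φ(z)`. -/
def secantSpan {n k : ℕ} (Φ : EuclideanSpace ℝ (Fin n) → EuclideanSpace ℝ (Fin n))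
    (z : EuclideanSpace ℝ (Fin n)) (σ : ℝ) (ξ : Fin k → EuclideanSpace ℝ (Fin n)) :
    Submodule ℝ (EuclideanSpace ℝ (Fin n)) :=
  Submodule.span ℝ (range fun i => Φ (z + σ • ξ i) - Φ z)

/-- The deviation `‖P_T^⊥ P_{S_k}‖₂`. -/
def secantDeviation {n k : ℕ} (M : Set (EuclideanSpace ℝ (Fin n)))
    (Φ : EuclideanSpace ℝ (Fin n) → EuclideanSpace ℝ (Fin n)) (z : EuclideanSpace ℝ (Fin n))
    (σ : ℝ) (ξ : Fin k → EuclideanSpace ℝ (Fin n)) : ℝ :=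
  ‖((footTangent M Φ z)ᗮ.starProjection).comp (secantSpan Φ z σ ξ).starProjection‖

/-- The second-order matrix `R = [R₁, …, R_k]`, `R_i = (σ² / 2) D²Φ(z)[ξ_i, ξ_i]`. -/
def secondOrderMatrix {n k : ℕ} (Φ : EuclideanSpace ℝ (Fin n) → EuclideanSpace ℝ (Fin n))
    (z : EuclideanSpace ℝ (Fin n)) (σ : ℝ) (ξ : Fin k → EuclideanSpace ℝ (Fin n)) :
    EuclideanSpace ℝ (Fin k) →L[ℝ] EuclideanSpace ℝ (Fin n) :=
  colMatrix fun i => (σ ^ 2 / 2) • iteratedFDeriv ℝ 2 Φ z ![ξ i, ξ i]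

/-- A manifold with a tube of radius `ρ`, a probability-flow map into the tube and a base point `z`.
The map is `C³` on the ball of radius `r` around `z`, with second and third derivatives at most `B`
there. -/
structure IsTubeFlow {n : ℕ} (d : ℕ) (M : Set (EuclideanSpace ℝ (Fin n))) (κ ρ : ℝ)
    (Φ : EuclideanSpace ℝ (Fin n) → EuclideanSpace ℝ (Fin n)) (z : EuclideanSpace ℝ (Fin n))
    (r B : ℝ) : Prop where
  submanifold : IsSmoothSubmanifold d M
  curvature : HasCurvatureBound M κ
  radius_pos : 0 < ρ
  radius_lt_reach : ENNReal.ofReal ρ < reach M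
  flow : IsProbabilityFlowMap Φ
  mapsTo_tube : ∀ w, Φ w ∈ Metric.cthickening ρ M
  contDiffOn : ContDiffOn ℝ 3 Φ (Metric.ball z r)
  second_deriv_le : ∀ w ∈ Metric.ball z r, ‖iteratedFDeriv ℝ 2 Φ w‖ ≤ B
  third_deriv_le : ∀ w ∈ Metric.ball z r, ‖iteratedFDeriv ℝ 3 Φ w‖ ≤ B

/-- Near-tangency of the differential, `‖P_T^⊥ DΦ(z)‖₂ ≤ L_⊥ ρ`, and curvature control of the normal
second-order deviation, `‖P_T^⊥ R‖₂ ≤ C_curv κ σ² ‖Ξ‖₂²`. -/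
structure IsNearTangent {n k : ℕ} (M : Set (EuclideanSpace ℝ (Fin n))) (κ ρ : ℝ)
    (Φ : EuclideanSpace ℝ (Fin n) → EuclideanSpace ℝ (Fin n)) (z : EuclideanSpace ℝ (Fin n))
    (σ : ℝ) (ξ : Fin k → EuclideanSpace ℝ (Fin n)) (Lperp Ccurv : ℝ) : Prop where
  differential : ‖((footTangent M Φ z)ᗮ.starProjection).comp (fderiv ℝ Φ z)‖ ≤ Lperp * ρ
  second_order : ‖((footTangent M Φ z)ᗮ.starProjection).comp (secondOrderMatrix Φ z σ ξ)‖ ≤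
    Ccurv * κ * σ ^ 2 * ‖colMatrix ξ‖ ^ 2

end

/-! Write `V` for the matrix of secants and `Ξ` for `colMatrix ξ`. Taylor expansion gives `V = σ
DΦ(z) Ξ + R + E` with `E = O(σ³)`. Every vector of the secant span is some `V a`, so the deviation
is at most the quotient of an upper bound for `‖P_T^⊥ V a‖ / ‖a‖` by a lower bound for `‖V a‖ /
‖a‖`; both carry a factor `σ`, which cancels. The upper bound is near-tangency, the curvature
hypothesis and the Taylor remainder, term by term.

The lower bound has to come from `s_min`, which concerns `π ∘ Φ` and not `Φ`. On the tube `π` is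
Lipschitz with constant `1 / (1 - 2ρ/τ)` (`dist_nearest_le`), hence `‖DΦ(z) Ξ a‖ ≥ (1 - 2ρ/τ) s_min
‖a‖`; `R` and `E` cost a further `O(σ)`. So the denominator is `(1 - δ) s_min` with `δ = O(ρ + σ)`.
For small `δ` this is a factor `1 + ε`. If `ρ = O(σ)`, the excess `2δ` times main terms of size
`O(σ)` is `O(σ²)` and goes into `C₃`.

The Lipschitz bound is Federer's. Its core is that a normal ray realizes the distance to `M` up to
the reach, obtained by repeated doubling (`infDist_reflect_nearest`). -/

/-! ### Federer's estimates from uniqueness of nearest points -/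

section ReachGeometry

/-- Nearest points depend continuously on the base point where the nearest point is unique. -/
theorem tendsto_of_isNearest_of_unique {E : Type*} [NormedAddCommGroup E] [ProperSpace E]
    {M : Set E} (hM : IsClosed M) {y p : E}
    (huniq : ∀ q ∈ M, dist y q = Metric.infDist y M → q = p)
    {x q : ℕ → E} (hx : Tendsto x atTop (𝓝 y)) (hq : ∀ n, q n ∈ M)
    (hd : ∀ n, dist (x n) (q n) = Metric.infDist (x n) M) : Tendsto q atTop (𝓝 p) := by
  have hdist : Tendsto (fun n => dist (x n) (q n)) atTop (𝓝 (Metric.infDist y M)) := by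
    simp only [hd]
    exact ((Metric.continuous_infDist_pt M).tendsto y).comp hx
  -- By compactness every subsequence has a convergent further subsequence, and its limit is a
  -- nearest point of `y`, hence `p`.
  refine tendsto_of_subseq_tendsto fun ns hns => ?_
  have hx' := hx.comp hns
  have hd' := hdist.comp hns
  obtain ⟨R, hR⟩ := hx'.norm.bddAbove_range
  obtain ⟨R', hR'⟩ := hd'.bddAbove_range
  have hmem : ∀ n, q (ns n) ∈ Metric.closedBall (0 : E) (R + R') := fun n => by
    have h1 : ‖x (ns n)‖ ≤ R := hR (mem_range_self n)
    have h2 : dist (x (ns n)) (q (ns n)) ≤ R' := hR' (mem_range_self n)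
    rw [mem_closedBall_zero_iff]
    rw [dist_comm, dist_eq_norm] at h2
    linarith [norm_le_norm_add_norm_sub' (q (ns n)) (x (ns n))]
  obtain ⟨a, -, φ, hφ, ha⟩ := (isCompact_closedBall (0 : E) (R + R')).tendsto_subseq hmem
  have haM : a ∈ M := hM.mem_of_tendsto ha (Eventually.of_forall fun n => hq _)
  have hda : dist y a = Metric.infDist y M :=
    tendsto_nhds_unique ((hx'.comp hφ.tendsto_atTop).dist ha) (hd'.comp hφ.tendsto_atTop)
  rw [← huniq a haM hda]
  exact ⟨φ, ha⟩

variable {E : Type*} [NormedAddCommGroup E] [InnerProductSpace ℝ E] [ProperSpace E] {M : Set E}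

/-- If the distance to `M` does not increase from `y` in the direction `v`, then `v` makes an angle of
at least `π / 2` with `y - p`, where `p` is the nearest point of `y`. -/
theorem inner_sub_nearest_nonpos (hM : IsClosed M) {y p : E} (hp : p ∈ M)
    (huniq : ∀ q ∈ M, dist y q = Metric.infDist y M → q = p) {v : E}
    (hv : ∀ᶠ h : ℝ in 𝓝[>] 0, Metric.infDist (y + h • v) M ≤ Metric.infDist y M) :
    inner ℝ v (y - p) ≤ 0 := by
  have hlim : Tendsto (fun n : ℕ => ((n : ℝ) + 1)⁻¹) atTop (𝓝[>] 0) := by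
    refine tendsto_nhdsWithin_iff.2 ⟨?_, Eventually.of_forall fun n => ?_⟩
    · simpa only [one_div] using tendsto_one_div_add_atTop_nhds_zero_nat (𝕜 := ℝ)
    · exact mem_Ioi.2 (inv_pos.2 (by positivity))
  choose q hqM hq using fun x : E => hM.exists_infDist_eq_dist ⟨p, hp⟩ x
  have hx : Tendsto (fun n : ℕ => y + ((n : ℝ) + 1)⁻¹ • v) atTop (𝓝 y) := by
    have := ((tendsto_nhds_of_tendsto_nhdsWithin hlim).smul_const v).const_add y
    simpa using this
  have hqlim := tendsto_of_isNearest_of_unique hM huniq hx (fun n => hqM _) (fun n => (hq _).symm)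
  refine le_of_tendsto ((tendsto_const_nhds (x := v)).inner
    ((tendsto_const_nhds (x := y)).sub hqlim)) ?_
  filter_upwards [hlim.eventually hv] with n hn
  set h : ℝ := ((n : ℝ) + 1)⁻¹
  have hpos : 0 < h := inv_pos.2 (by positivity)
  set b := q (y + h • v)
  -- Both distances are measured to the nearest point `b` of the displaced point, so no derivative
  -- of the distance function is needed.
  have h1 : ‖y + h • v - b‖ ≤ ‖y - b‖ := by
    rw [← dist_eq_norm, ← dist_eq_norm, ← hq]
    exact hn.trans (Metric.infDist_le_dist_of_mem (hqM _))
  have h2 : ‖y + h • v - b‖ ^ 2 = ‖y - b‖ ^ 2 + 2 * (h * inner ℝ v (y - b)) + ‖h • v‖ ^ 2 := by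
    rw [show y + h • v - b = (y - b) + h • v by abel, norm_add_sq_real, inner_smul_right,
      real_inner_comm]
  have h3 : ‖y + h • v - b‖ ^ 2 ≤ ‖y - b‖ ^ 2 := by gcongr
  have h4 : h * inner ℝ v (y - b) ≤ 0 := by nlinarith [sq_nonneg ‖h • v‖]
  exact nonpos_of_mul_nonpos_right h4 hpos

/-- Reflecting a nearest point through `x` doubles the distance to `M`, as long as nearest points are
unique up to that distance. -/
theorem infDist_reflect_nearest (hM : IsClosed M) {T s : ℝ}
    (huniq : ∀ x, Metric.infDist x M < T → ∀ p ∈ M, ∀ q ∈ M,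
      dist x p = Metric.infDist x M → dist x q = Metric.infDist x M → p = q)
    {x a : E} (ha : a ∈ M) (hxa : dist x a = Metric.infDist x M) (hs : Metric.infDist x M = s)
    (hs0 : 0 < s) (hsT : 2 * s < T) : Metric.infDist (x + (x - a)) M = 2 * s := by
  -- The maximizer `y` of the distance on the ball turns out to be the reflected point: first-order
  -- optimality forces `y - p` to point radially outward.
  obtain ⟨y, hy, hmax⟩ := (isCompact_closedBall x s).exists_isMaxOn
    ⟨x, Metric.mem_closedBall_self hs0.le⟩ (Metric.continuous_infDist_pt M).continuousOn
  have hys : ‖y - x‖ ≤ s := by rwa [← dist_eq_norm]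
  have hDs : Metric.infDist y M ≤ 2 * s := by
    have := Metric.infDist_le_infDist_add_dist (s := M) (x := y) (y := x)
    rw [dist_eq_norm] at this
    linarith
  have hsD : s ≤ Metric.infDist y M := by
    rw [← hs]; exact hmax (Metric.mem_closedBall_self hs0.le)
  obtain ⟨p, hp, hyp⟩ := hM.exists_infDist_eq_dist ⟨a, ha⟩ y
  have hfirst : ∀ v, (∀ᶠ h : ℝ in 𝓝[>] 0, ‖y - x + h • v‖ ≤ s) → inner ℝ v (y - p) ≤ 0 := by
    intro v hv
    refine inner_sub_nearest_nonpos hM hp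
      (fun q hq hyq => huniq y (by linarith) q hq p hp hyq hyp.symm) ?_
    filter_upwards [hv] with h hh
    refine hmax ?_
    rw [Metric.mem_closedBall, dist_eq_norm, add_sub_right_comm]
    exact hh
  set u := y - x with hu
  set w := y - p with hw
  have hwD : ‖w‖ = Metric.infDist y M := by rw [hw, ← dist_eq_norm, hyp]
  have hwpos : 0 < ‖w‖ := by linarith
  -- At an interior maximizer, moving away from `p` would be admissible.
  have hus : ‖u‖ = s := by
    by_contra hne
    have hlt : ‖u‖ < s := lt_of_le_of_ne hys hne
    have hc : Tendsto (fun h : ℝ => ‖u + h • w‖) (𝓝[>] 0) (𝓝 ‖u‖) := by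
      have : Continuous fun h : ℝ => ‖u + h • w‖ := by fun_prop
      simpa using (this.tendsto 0).mono_left nhdsWithin_le_nhds
    have := hfirst w ((hc.eventually_lt_const hlt).mono fun h hh => hh.le)
    rw [real_inner_self_eq_norm_sq] at this
    nlinarith
  have huw : inner ℝ u w = ‖u‖ * ‖w‖ := by
    refine le_antisymm (real_inner_le_norm u w) ?_
    by_contra! hlt
    rw [hus] at hlt
    -- If `u` and `w` were not aligned, this direction would enter the ball and still increase the
    -- distance.
    set v := s • w - ‖w‖ • u with hv
    have hvu : inner ℝ u v = s * (inner ℝ u w - s * ‖w‖) := by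
      rw [hv, inner_sub_right, inner_smul_right, inner_smul_right, real_inner_self_eq_norm_sq, hus]
      ring
    have hvw : inner ℝ v w = ‖w‖ * (s * ‖w‖ - inner ℝ u w) := by
      rw [hv, inner_sub_left, inner_smul_left, inner_smul_left, real_inner_self_eq_norm_sq]
      simp only [conj_trivial]
      ring
    have hneg : inner ℝ u v < 0 := by
      rw [hvu]; exact mul_neg_of_pos_of_neg hs0 (by linarith)
    have hc : Tendsto (fun h : ℝ => 2 * inner ℝ u v + h * ‖v‖ ^ 2) (𝓝[>] 0)
        (𝓝 (2 * inner ℝ u v)) := by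
      have : Continuous fun h : ℝ => 2 * inner ℝ u v + h * ‖v‖ ^ 2 := by fun_prop
      simpa using (this.tendsto 0).mono_left nhdsWithin_le_nhds
    have := hfirst v (by
      filter_upwards [hc.eventually_lt_const (by linarith : 2 * inner ℝ u v < 0),
        self_mem_nhdsWithin] with h hh (hpos : 0 < h)
      refine le_of_sq_le_sq ?_ hs0.le
      rw [norm_add_sq_real, inner_smul_right, norm_smul, hus, mul_pow, Real.norm_eq_abs, sq_abs]
      nlinarith)
    rw [hvw] at this
    have : 0 < ‖w‖ * (s * ‖w‖ - inner ℝ u w) := mul_pos hwpos (by linarith)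
    linarith
  have hpar : ‖w‖ • u = s • w := by
    rw [← hus]; exact inner_eq_norm_mul_iff_real.1 huw
  have hxp : ‖x - p‖ = ‖w‖ - s := by
    have h1 : ‖w‖ • (x - p) = (‖w‖ - s) • w := by
      rw [show x - p = w - u by rw [hw, hu]; abel, smul_sub, hpar, sub_smul]
    have h2 := congrArg norm h1
    rw [norm_smul, norm_smul, norm_norm, Real.norm_eq_abs, abs_of_nonneg (by linarith)] at h2
    exact mul_left_cancel₀ hwpos.ne' (by linarith)
  have hge : s ≤ ‖x - p‖ := by
    rw [← hs, ← dist_eq_norm]; exact Metric.infDist_le_dist_of_mem hp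
  have hw2 : ‖w‖ = 2 * s := by linarith
  have hpa : p = a := huniq x (by linarith) p hp a ha (by rw [dist_eq_norm]; linarith) hxa
  have hy2 : x + (x - a) = y := by
    rw [hw2, mul_smul, smul_comm (2 : ℝ) s] at hpar
    have := smul_right_injective E hs0.ne' hpar
    rw [← hpa]
    simp only [two_smul, hu, hw] at this
    have : (y - x) + (y - x) - (y - p) = 0 := by rw [this, sub_self]
    have h4 : x + (x - p) = y - ((y - x) + (y - x) - (y - p)) := by abel
    rw [h4, this, sub_zero]
  rw [hy2, ← hwD, hw2]

/-- The normal ray through a point with nearest point `a` realizes the distance to `M` up to the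
radius of unique nearest points. -/
theorem infDist_normal_ray (hM : IsClosed M) {T t₀ : ℝ}
    (huniq : ∀ x, Metric.infDist x M < T → ∀ p ∈ M, ∀ q ∈ M,
      dist x p = Metric.infDist x M → dist x q = Metric.infDist x M → p = q)
    {a e : E} (ha : a ∈ M) (he : ‖e‖ = 1) (ht₀ : 0 < t₀)
    (h₀ : Metric.infDist (a + t₀ • e) M = t₀) {t : ℝ} (ht : 0 ≤ t) (htT : t < T) :
    Metric.infDist (a + t • e) M = t := by
  have hda : ∀ t, 0 ≤ t → dist (a + t • e) a = t := fun t ht => by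
    rw [dist_eq_norm, add_sub_cancel_left, norm_smul, he, mul_one, Real.norm_eq_abs,
      abs_of_nonneg ht]
  have key : ∀ m : ℕ, ∀ t, 0 ≤ t → t ≤ 2 ^ m * t₀ → t < T → Metric.infDist (a + t • e) M = t := by
    intro m
    induction m with
    | zero =>
      intro t ht hle _
      rw [pow_zero, one_mul] at hle
      refine le_antisymm ((Metric.infDist_le_dist_of_mem ha).trans (hda t ht).le) ?_
      have h1 := Metric.infDist_le_infDist_add_dist (s := M) (x := a + t₀ • e) (y := a + t • e)
      rw [h₀, dist_eq_norm, add_sub_add_left_eq_sub, ← sub_smul, norm_smul, he, mul_one,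
        Real.norm_eq_abs, abs_of_nonneg (by linarith)] at h1
      linarith
    | succ m ih =>
      intro t ht hle hlt
      rcases ht.eq_or_lt with rfl | hpos
      · simpa using Metric.infDist_zero_of_mem ha
      have h2 := ih (t / 2) (by linarith) (by rw [pow_succ] at hle; linarith) (by linarith)
      -- The point at parameter `t` is the reflection of `a` through the one at `t / 2`.
      have h3 := infDist_reflect_nearest hM huniq ha ((hda _ (by linarith)).trans h2.symm) h2
        (by linarith) (by linarith)
      rw [add_sub_cancel_left, add_assoc, ← add_smul, add_halves] at h3
      linarith
  obtain ⟨m, hm⟩ := pow_unbounded_of_one_lt (t / t₀) one_lt_two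
  exact key m t ht ((div_le_iff₀ ht₀).1 hm.le) htT

/-- Federer's estimate for the normal vector at a nearest point. -/
theorem inner_sub_nearest_le (hM : IsClosed M) {T ρ t : ℝ}
    (huniq : ∀ x, Metric.infDist x M < T → ∀ p ∈ M, ∀ q ∈ M,
      dist x p = Metric.infDist x M → dist x q = Metric.infDist x M → p = q)
    (ht : 0 < t) (htT : t < T) {x a b : E} (ha : a ∈ M) (hb : b ∈ M)
    (hxa : dist x a = Metric.infDist x M) (hxρ : Metric.infDist x M ≤ ρ) :
    inner ℝ (x - a) (b - a) ≤ ρ / (2 * t) * ‖b - a‖ ^ 2 := by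
  have hρ : 0 ≤ ρ := Metric.infDist_nonneg.trans hxρ
  rcases eq_or_ne x a with rfl | hne
  · simp only [sub_self, inner_zero_left]; positivity
  set δ := ‖x - a‖ with hδ
  have hδpos : 0 < δ := norm_pos_iff.2 (sub_ne_zero.2 hne)
  have hδρ : δ ≤ ρ := by rw [hδ, ← dist_eq_norm, hxa]; exact hxρ
  set e := δ⁻¹ • (x - a) with he
  have hxe : x - a = δ • e := by rw [he, smul_inv_smul₀ hδpos.ne']
  have he1 : ‖e‖ = 1 := by
    rw [he, norm_smul, norm_inv, Real.norm_eq_abs, abs_of_pos hδpos, ← hδ,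
      inv_mul_cancel₀ hδpos.ne']
  have h0 : Metric.infDist (a + δ • e) M = δ := by
    rw [← hxe, add_sub_cancel, ← hxa, dist_eq_norm]
  have hray := infDist_normal_ray hM huniq ha he1 hδpos h0 ht.le htT
  -- The open ball of radius `t` about `a + t • e` misses `M`; expanding the square gives the
  -- estimate.
  have h1 : t ≤ ‖t • e - (b - a)‖ := by
    have := Metric.infDist_le_dist_of_mem (x := a + t • e) hb
    rw [hray, dist_eq_norm] at this
    rwa [show t • e - (b - a) = a + t • e - b by abel]
  have h2 : t ^ 2 ≤ t ^ 2 - 2 * (t * inner ℝ e (b - a)) + ‖b - a‖ ^ 2 := by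
    have h3 : t ^ 2 ≤ ‖t • e - (b - a)‖ ^ 2 := by gcongr
    rwa [norm_sub_sq_real, inner_smul_left, norm_smul, he1, mul_one, Real.norm_eq_abs, sq_abs,
      conj_trivial] at h3
  have h3 : inner ℝ e (b - a) ≤ ‖b - a‖ ^ 2 / (2 * t) := by
    rw [le_div_iff₀ (by positivity)]; linarith
  calc inner ℝ (x - a) (b - a) = δ * inner ℝ e (b - a) := by
        rw [hxe, inner_smul_left, conj_trivial]
    _ ≤ δ * (‖b - a‖ ^ 2 / (2 * t)) := by gcongr
    _ ≤ ρ * (‖b - a‖ ^ 2 / (2 * t)) := by gcongr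
    _ = _ := by ring

/-- Federer's Lipschitz estimate for the nearest-point projection on the tube of radius `ρ`. -/
theorem dist_nearest_le (hM : IsClosed M) {T ρ t : ℝ}
    (huniq : ∀ x, Metric.infDist x M < T → ∀ p ∈ M, ∀ q ∈ M,
      dist x p = Metric.infDist x M → dist x q = Metric.infDist x M → p = q)
    (ht : 0 < t) (htT : t < T) {x y a b : E} (ha : a ∈ M) (hb : b ∈ M)
    (hxa : dist x a = Metric.infDist x M) (hyb : dist y b = Metric.infDist y M)
    (hxρ : Metric.infDist x M ≤ ρ) (hyρ : Metric.infDist y M ≤ ρ) :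
    (1 - ρ / t) * ‖b - a‖ ≤ ‖y - x‖ := by
  rcases eq_or_ne b a with rfl | hne
  · simp
  have hpos : 0 < ‖b - a‖ := norm_pos_iff.2 (sub_ne_zero.2 hne)
  have h1 := inner_sub_nearest_le hM huniq ht htT ha hb hxa hxρ
  have h2 := inner_sub_nearest_le hM huniq ht htT hb ha hyb hyρ
  rw [norm_sub_rev] at h2
  have h3 : inner ℝ (y - b) (a - b) = -inner ℝ (y - b) (b - a) := by
    rw [← inner_neg_right, neg_sub]
  -- Federer's estimate at both ends bounds this inner product below by `(1 - ρ / t) ‖b - a‖²`;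
  -- Cauchy–Schwarz finishes.
  have h4 : inner ℝ (y - x) (b - a)
      = ‖b - a‖ ^ 2 + inner ℝ (y - b) (b - a) - inner ℝ (x - a) (b - a) := by
    rw [← real_inner_self_eq_norm_sq, ← inner_add_left, ← inner_sub_left]
    congr 1; abel
  have h5 := real_inner_le_norm (y - x) (b - a)
  have h6 : ρ / (2 * t) * ‖b - a‖ ^ 2 + ρ / (2 * t) * ‖b - a‖ ^ 2 = ρ / t * ‖b - a‖ ^ 2 := by
    field_simp; ring
  refine le_of_mul_le_mul_right ?_ hpos
  nlinarith

end ReachGeometry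

/-! ### Taylor expansion, singular values and differentials -/

/-- Second-order Taylor estimate on a ball with third derivative at most `B`. -/
theorem norm_taylor_two_le {E F : Type*} [NormedAddCommGroup E] [NormedSpace ℝ E]
    [NormedAddCommGroup F] [NormedSpace ℝ F] {f : E → F} {z v : E} {r B : ℝ}
    (hf : ContDiffOn ℝ 3 f (Metric.ball z r))
    (hB : ∀ w ∈ Metric.ball z r, ‖iteratedFDeriv ℝ 3 f w‖ ≤ B) (hv : ‖v‖ < r) :
    ‖f (z + v) - f z - fderiv ℝ f z v - (1 / 2 : ℝ) • iteratedFDeriv ℝ 2 f z ![v, v]‖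
      ≤ B * ‖v‖ ^ 3 := by
  have hr : 0 < r := (norm_nonneg v).trans_lt hv
  have hB0 : 0 ≤ B := (norm_nonneg _).trans (hB z (Metric.mem_ball_self hr))
  have hcd : ∀ w ∈ Metric.ball z r, ContDiffAt ℝ 3 f w := fun w hw =>
    hf.contDiffAt (Metric.isOpen_ball.mem_nhds hw)
  have hmem : ∀ t ∈ Icc (0 : ℝ) 1, z + t • v ∈ Metric.ball z r := fun t ht => by
    rw [Metric.mem_ball, dist_eq_norm, add_sub_cancel_left, norm_smul, Real.norm_eq_abs,
      abs_of_nonneg ht.1]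
    exact (mul_le_of_le_one_left (norm_nonneg v) ht.2).trans_lt hv
  have hline : ∀ t : ℝ, HasDerivAt (fun t : ℝ => z + t • v) v t := fun t => by
    simpa using ((hasDerivAt_id t).smul_const v).const_add z
  -- Three mean value inequalities, each on a segment of parameter length at most one, give the
  -- constant `B` in place of the sharp `B / 6`.
  have hlip : ∀ t ∈ Icc (0 : ℝ) 1,
      ‖iteratedFDeriv ℝ 2 f (z + t • v) ![v, v] - iteratedFDeriv ℝ 2 f z ![v, v]‖
        ≤ B * ‖v‖ ^ 3 := by
    intro t ht
    have h1 : ‖iteratedFDeriv ℝ 2 f (z + t • v) - iteratedFDeriv ℝ 2 f z‖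
        ≤ B * ‖z + t • v - z‖ := by
      refine (convex_ball z r).norm_image_sub_le_of_norm_fderiv_le (𝕜 := ℝ)
        (fun w hw => (hcd w hw).differentiableAt_iteratedFDeriv (by norm_cast))
        (fun w hw => ?_) (Metric.mem_ball_self hr) (hmem t ht)
      rw [norm_fderiv_iteratedFDeriv]
      exact hB w hw
    have h2 : ‖z + t • v - z‖ ≤ ‖v‖ := by
      rw [add_sub_cancel_left, norm_smul, Real.norm_eq_abs, abs_of_nonneg ht.1]
      exact mul_le_of_le_one_left (norm_nonneg v) ht.2
    have h3 := (iteratedFDeriv ℝ 2 f (z + t • v) - iteratedFDeriv ℝ 2 f z).le_opNorm ![v, v]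
    rw [_root_.sub_apply, Fin.prod_univ_two] at h3
    refine h3.trans ?_
    calc _ ≤ B * ‖v‖ * (‖v‖ * ‖v‖) := by
          simp only [Matrix.cons_val_zero, Matrix.cons_val_one]
          gcongr
          exact h1.trans (by gcongr)
      _ = _ := by ring
  have hderiv : ∀ t ∈ Icc (0 : ℝ) 1, HasDerivAt (fun t : ℝ => fderiv ℝ f (z + t • v) v)
      (iteratedFDeriv ℝ 2 f (z + t • v) ![v, v]) t := by
    intro t ht
    have h1 : DifferentiableAt ℝ (fderiv ℝ f) (z + t • v) :=
      ((hcd _ (hmem t ht)).fderiv_right (m := 2) (by norm_num)).differentiableAt (by norm_num)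
    have h2 := (ContinuousLinearMap.apply ℝ F v).hasFDerivAt.comp_hasDerivAt t
      (h1.hasFDerivAt.comp_hasDerivAt t (hline t))
    rw [iteratedFDeriv_two_apply]
    exact h2
  have hfirst : ∀ t ∈ Icc (0 : ℝ) 1,
      ‖fderiv ℝ f (z + t • v) v - fderiv ℝ f z v - t • iteratedFDeriv ℝ 2 f z ![v, v]‖
        ≤ B * ‖v‖ ^ 3 := by
    intro t ht
    have h := norm_image_sub_le_of_norm_deriv_le_segment' (a := (0 : ℝ)) (b := 1)
      (f := fun t : ℝ => fderiv ℝ f (z + t • v) v - t • iteratedFDeriv ℝ 2 f z ![v, v])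
      (f' := fun t => iteratedFDeriv ℝ 2 f (z + t • v) ![v, v] - iteratedFDeriv ℝ 2 f z ![v, v])
      (C := B * ‖v‖ ^ 3)
      (fun s hs => ((hderiv s hs).sub (by
        simpa using (hasDerivAt_id s).smul_const (iteratedFDeriv ℝ 2 f z ![v, v]))).hasDerivWithinAt)
      (fun s hs => hlip s ⟨hs.1, hs.2.le⟩) t ht
    simp only [zero_smul, add_zero, sub_zero] at h
    rw [sub_right_comm]
    exact h.trans (mul_le_of_le_one_right (by positivity) ht.2)
  have h := norm_image_sub_le_of_norm_deriv_le_segment_01'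
    (f := fun t : ℝ => f (z + t • v) - t • fderiv ℝ f z v
      - (t ^ 2 / 2) • iteratedFDeriv ℝ 2 f z ![v, v])
    (f' := fun t => fderiv ℝ f (z + t • v) v - fderiv ℝ f z v
      - t • iteratedFDeriv ℝ 2 f z ![v, v])
    (C := B * ‖v‖ ^ 3)
    (fun t ht => by
      have h1 := ((hcd _ (hmem t ht)).differentiableAt (by norm_num)).hasFDerivAt.comp_hasDerivAt t
        (hline t)
      have h2 : HasDerivAt (fun t : ℝ => t • fderiv ℝ f z v) (fderiv ℝ f z v) t := by
        simpa using (hasDerivAt_id t).smul_const (fderiv ℝ f z v)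
      have h3 : HasDerivAt (fun t : ℝ => t ^ 2 / 2) t t := by
        simpa using (hasDerivAt_pow 2 t).div_const 2
      exact ((h1.sub h2).sub (h3.smul_const _)).hasDerivWithinAt)
    (fun t ht => hfirst t ⟨ht.1, ht.2.le⟩)
  convert h using 2
  simp only [one_smul, one_pow, zero_smul, add_zero, sub_zero, ne_eq, OfNat.ofNat_ne_zero,
    not_false_eq_true, zero_pow, zero_div]
  abel

/-- The last singular value bounds the operator from below. -/
theorem LinearMap.singularValues_finrank_sub_one_mul_norm_le {E F : Type*}
    [NormedAddCommGroup E] [InnerProductSpace ℝ E] [FiniteDimensional ℝ E]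
    [NormedAddCommGroup F] [InnerProductSpace ℝ F] [FiniteDimensional ℝ F]
    (T : E →ₗ[ℝ] F) {k : ℕ} (hk : Module.finrank ℝ E = k) (x : E) :
    T.singularValues (k - 1) * ‖x‖ ≤ ‖T x‖ := by
  have hS := T.isSymmetric_adjoint_comp_self
  set b := hS.eigenvectorBasis hk
  refine le_of_sq_le_sq ?_ (norm_nonneg _)
  have h1 : ‖T x‖ ^ 2 = ∑ i, hS.eigenvalues hk i * (inner ℝ (b i) x) ^ 2 := by
    have : ‖T x‖ ^ 2 = inner ℝ x ((T.adjoint ∘ₗ T) x) := by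
      rw [LinearMap.comp_apply, LinearMap.adjoint_inner_right, real_inner_self_eq_norm_sq]
    rw [this, ← b.sum_inner_mul_inner]
    refine Finset.sum_congr rfl fun i _ => ?_
    rw [← hS, hS.apply_eigenvectorBasis, inner_smul_left, real_inner_comm x]
    simp only [conj_trivial, RCLike.ofReal_real_eq_id, _root_.id, b]
    ring
  have h2 : ‖x‖ ^ 2 = ∑ i, (inner ℝ (b i) x) ^ 2 := by
    simpa [Real.norm_eq_abs, sq_abs] using (b.sum_sq_norm_inner_right x).symm
  rw [mul_pow, h1, h2, Finset.mul_sum]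
  refine Finset.sum_le_sum fun i _ => ?_
  gcongr
  rw [← T.sq_singularValues_fin hk]
  gcongr
  · exact T.singularValues_nonneg _
  -- Indices start at `0`, so `k - 1` is the last one; for `k = 0` the sums are empty.
  · exact T.singularValues_antitone (by omega)

/-- A bound of the increments of `g` by those of `f` passes to the differentials. -/
theorem mul_norm_fderiv_le {E F G : Type*} [NormedAddCommGroup E] [NormedSpace ℝ E]
    [NormedAddCommGroup F] [NormedSpace ℝ F] [NormedAddCommGroup G] [NormedSpace ℝ G]
    {f : E → F} {g : E → G} {z : E} {c : ℝ} (hf : DifferentiableAt ℝ f z)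
    (h : ∀ w, c * ‖g w - g z‖ ≤ ‖f w - f z‖) (v : E) :
    c * ‖fderiv ℝ g z v‖ ≤ ‖fderiv ℝ f z v‖ := by
  by_cases hg : DifferentiableAt ℝ g z
  · have h1 := (hf.hasFDerivAt.hasLineDerivAt v).tendsto_slope_zero.norm
    have h2 := ((hg.hasFDerivAt.hasLineDerivAt v).tendsto_slope_zero.norm).const_mul c
    refine le_of_tendsto_of_tendsto' h2 h1 fun t => ?_
    simp only [norm_smul]
    rw [mul_left_comm]
    gcongr
    exact h _
  -- Without differentiability of `g`, `fderiv` is `0` by convention and the bound is trivial;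
  -- smoothness of the projection is never needed.
  · simp [fderiv_zero_of_not_differentiableAt hg]

/-! ### Column matrices and the span of their columns -/

theorem colMatrix_apply {n k : ℕ} (v : Fin k → EuclideanSpace ℝ (Fin n))
    (a : EuclideanSpace ℝ (Fin k)) : colMatrix v a = ∑ i, a i • v i := by
  simp [colMatrix]

theorem norm_le_norm_colMatrix {n k : ℕ} (v : Fin k → EuclideanSpace ℝ (Fin n)) (i : Fin k) :
    ‖v i‖ ≤ ‖colMatrix v‖ := by
  have := (colMatrix v).le_opNorm (EuclideanSpace.single i 1)
  simpa [colMatrix_apply, Pi.single_apply] using this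

theorem norm_colMatrix_le {n k : ℕ} {v : Fin k → EuclideanSpace ℝ (Fin n)} {C : ℝ}
    (hC : ∀ i, ‖v i‖ ≤ C) : ‖colMatrix v‖ ≤ k * C := by
  refine (norm_sum_le _ _).trans ?_
  have : ∀ i ∈ Finset.univ, ‖(EuclideanSpace.proj i :
      EuclideanSpace ℝ (Fin k) →L[ℝ] ℝ).smulRight (v i)‖ ≤ C := fun i _ => by
    refine ContinuousLinearMap.opNorm_le_bound _ ((norm_nonneg _).trans (hC i)) fun a => ?_
    rw [ContinuousLinearMap.smulRight_apply, norm_smul, mul_comm]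
    gcongr
    · exact (norm_nonneg _).trans (hC i)
    · exact hC i
    · exact PiLp.norm_apply_le a i
  simpa using Finset.sum_le_sum this

theorem colMatrix_range {n k : ℕ} (v : Fin k → EuclideanSpace ℝ (Fin n))
    {x : EuclideanSpace ℝ (Fin n)} (hx : x ∈ Submodule.span ℝ (range v)) :
    ∃ a, colMatrix v a = x := by
  obtain ⟨c, hc⟩ := (Submodule.mem_span_range_iff_exists_fun ℝ).1 hx
  exact ⟨WithLp.toLp 2 c, by simpa [colMatrix_apply] using hc⟩

/-- An operator which is small on `colMatrix v a` and a lower bound of `colMatrix v` bound the operator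
on the span of the columns. -/
theorem norm_comp_starProjection_span_le {n k : ℕ} (v : Fin k → EuclideanSpace ℝ (Fin n))
    (P : EuclideanSpace ℝ (Fin n) →L[ℝ] EuclideanSpace ℝ (Fin n)) {m N : ℝ} (hm : 0 < m)
    (hN : 0 ≤ N) (hlow : ∀ a, m * ‖a‖ ≤ ‖colMatrix v a‖)
    (hup : ∀ a, ‖P (colMatrix v a)‖ ≤ N * ‖a‖) :
    ‖P.comp (Submodule.span ℝ (range v)).starProjection‖ ≤ N / m := by
  refine ContinuousLinearMap.opNorm_le_bound _ (by positivity) fun x => ?_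
  set S := Submodule.span ℝ (range v)
  -- Some coefficient vector represents the projection of `x`; the lower bound then controls its
  -- norm.
  obtain ⟨a, ha⟩ := colMatrix_range v (S.starProjection_apply_mem x)
  have h1 : ‖S.starProjection x‖ ≤ ‖x‖ := S.norm_starProjection_apply_le x
  rw [ContinuousLinearMap.comp_apply, ← ha]
  rw [← ha] at h1
  refine (hup a).trans ?_
  rw [div_mul_eq_mul_div, le_div_iff₀ hm, mul_assoc, mul_comm _ m]
  gcongr
  exact (hlow a).trans h1

/-! ### The nearest-point projection of a set of positive reach -/

section Reach

variable {n : ℕ} {M : Set (EuclideanSpace ℝ (Fin n))} {τ T : ℝ}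

/-- A point of the closure has distance zero, so its nearest point, which exists by positivity of
the reach, is itself. -/
theorem isClosed_of_reach_pos (hM : 0 < reach M) : IsClosed M := by
  obtain ⟨R, hR, h0⟩ := lt_sSup_iff.1 hM
  refine isClosed_of_closure_subset fun x hx => ?_
  rw [Metric.mem_closure_iff_infEDist_zero] at hx
  obtain ⟨y, ⟨hy, hxy⟩, -⟩ := hR x (by rwa [hx])
  rw [hx, edist_eq_zero] at hxy
  rwa [hxy]

theorem edist_eq_infEDist_iff (hne : M.Nonempty) (x y : EuclideanSpace ℝ (Fin n)) :
    edist x y = Metric.infEDist x M ↔ dist x y = Metric.infDist x M := by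
  rw [dist_edist, Metric.infDist,
    ENNReal.toReal_eq_toReal_iff' (edist_ne_top x y) (Metric.infEDist_ne_top hne)]

/-- The reach is a supremum that need not be attained, hence the strict inequality `T < τ`. -/
theorem nearest_unique_of_lt_reach (hM : ENNReal.ofReal τ ≤ reach M) (hτ : 0 < τ) (hT : T < τ)
    (hne : M.Nonempty) (x : EuclideanSpace ℝ (Fin n)) (hx : Metric.infDist x M < T) :
    ∀ p ∈ M, ∀ q ∈ M, dist x p = Metric.infDist x M → dist x q = Metric.infDist x M → p = q := by
  obtain ⟨R, hR, hTR⟩ := lt_sSup_iff.1 (((ENNReal.ofReal_lt_ofReal_iff hτ).2 hT).trans_le hM)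
  have hlt : Metric.infEDist x M < R := by
    refine lt_trans ?_ hTR
    rwa [← ENNReal.ofReal_toReal (Metric.infEDist_ne_top hne (x := x)),
      ENNReal.ofReal_lt_ofReal_iff (Metric.infDist_nonneg.trans_lt hx)]
  intro p hp q hq hxp hxq
  exact (hR x hlt).unique ⟨hp, (edist_eq_infEDist_iff hne x p).2 hxp⟩
    ⟨hq, (edist_eq_infEDist_iff hne x q).2 hxq⟩

theorem nearestPoint_spec (hM : IsClosed M) (hne : M.Nonempty) (x : EuclideanSpace ℝ (Fin n)) :
    nearestPoint M x ∈ M ∧ dist x (nearestPoint M x) = Metric.infDist x M := by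
  have h : ∃ y, y ∈ M ∧ edist x y = Metric.infEDist x M := by
    obtain ⟨y, hy, hxy⟩ := hM.exists_infDist_eq_dist hne x
    exact ⟨y, hy, (edist_eq_infEDist_iff hne x y).2 hxy.symm⟩
  rw [← edist_eq_infEDist_iff hne, nearestPoint, dif_pos h]
  exact h.choose_spec

/-- The nearest-point projection is Lipschitz on the tube of radius `ρ`, with a constant which tends
to `1` with `ρ`. -/
theorem norm_nearestPoint_sub_le (hM : ENNReal.ofReal τ ≤ reach M) (hτ : 0 < τ) {ρ : ℝ}
    {x y : EuclideanSpace ℝ (Fin n)}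
    (hx : x ∈ Metric.cthickening ρ M) (hy : y ∈ Metric.cthickening ρ M) (hρ : 0 ≤ ρ) :
    (1 - 2 * ρ / τ) * ‖nearestPoint M y - nearestPoint M x‖ ≤ ‖y - x‖ := by
  have hcl : IsClosed M := isClosed_of_reach_pos ((ENNReal.ofReal_pos.2 hτ).trans_le hM)
  have hne : M.Nonempty := by
    by_contra h
    rw [not_nonempty_iff_eq_empty.1 h, Metric.cthickening_empty] at hx
    exact hx
  have hle : ∀ w ∈ Metric.cthickening ρ M, Metric.infDist w M ≤ ρ := fun w hw =>
    ENNReal.toReal_le_of_le_ofReal hρ (Metric.mem_cthickening_iff.1 hw)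
  -- Any `t < T < τ` would do; `t = τ / 2` produces the constant `2 * ρ / τ`.
  have h := dist_nearest_le hcl (T := 3 * τ / 4) (t := τ / 2)
    (nearest_unique_of_lt_reach hM hτ (by linarith) hne) (by linarith) (by linarith)
    (nearestPoint_spec hcl hne x).1 (nearestPoint_spec hcl hne y).1
    (nearestPoint_spec hcl hne x).2 (nearestPoint_spec hcl hne y).2 (hle x hx) (hle y hy)
  rwa [show ρ / (τ / 2) = 2 * ρ / τ by field_simp] at h

end Reach

/-! ### Deviation of the secant span from the tangent space -/

section Deviation

variable {n d k : ℕ} {M : Set (EuclideanSpace ℝ (Fin n))}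
  {Φ : EuclideanSpace ℝ (Fin n) → EuclideanSpace ℝ (Fin n)} {z : EuclideanSpace ℝ (Fin n)}
  {ξ : Fin k → EuclideanSpace ℝ (Fin n)} {κ ρ r B τ σ Lperp Ccurv s₀ : ℝ}

theorem tangentSignal_mul_norm_le (a : EuclideanSpace ℝ (Fin k)) :
    tangentSignal M Φ z ξ * ‖a‖ ≤ ‖fderiv ℝ (footMap M Φ) z (colMatrix ξ a)‖ :=
  LinearMap.singularValues_finrank_sub_one_mul_norm_le _ (finrank_euclideanSpace_fin) a

theorem norm_colMatrix_pos_of_tangentSignal_pos (hk : 1 ≤ k) (hs : 0 < tangentSignal M Φ z ξ) :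
    0 < ‖colMatrix ξ‖ := by
  -- A zero matrix would annihilate a unit vector, which exists as `k ≥ 1`.
  refine norm_pos_iff.2 fun h => ?_
  have := tangentSignal_mul_norm_le (M := M) (Φ := Φ) (z := z) (ξ := ξ)
    (EuclideanSpace.single ⟨0, hk⟩ 1)
  rw [h, _root_.zero_apply, map_zero, norm_zero, PiLp.norm_single,
    norm_one, mul_one] at this
  exact this.not_gt hs

/-- The lower bound for the secant matrix involves all of `R`, not only its normal part. This crude
bound suffices there, being one order in `σ` below the leading term. -/
theorem norm_secondOrderMatrix_le (hσ : 0 < σ) (hB : ‖iteratedFDeriv ℝ 2 Φ z‖ ≤ B) :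
    ‖secondOrderMatrix Φ z σ ξ‖ ≤ k * (σ ^ 2 / 2 * (B * ‖colMatrix ξ‖ ^ 2)) := by
  have hB0 : 0 ≤ B := (norm_nonneg _).trans hB
  refine norm_colMatrix_le fun i => ?_
  rw [norm_smul, Real.norm_eq_abs, abs_of_nonneg (by positivity)]
  gcongr
  refine ((iteratedFDeriv ℝ 2 Φ z).le_opNorm _).trans ?_
  rw [Fin.prod_univ_two, sq]
  simp only [Matrix.cons_val_zero, Matrix.cons_val_one]
  gcongr <;> exact norm_le_norm_colMatrix ξ i

/-- The secant matrix agrees with its second-order Taylor polynomial up to third order. -/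
theorem norm_secant_sub_taylor_le (hΦ : ContDiffOn ℝ 3 Φ (Metric.ball z r))
    (hB : ∀ w ∈ Metric.ball z r, ‖iteratedFDeriv ℝ 3 Φ w‖ ≤ B) (hB0 : 0 ≤ B) (hσ : 0 < σ)
    (hσr : σ * ‖colMatrix ξ‖ < r) :
    ‖colMatrix (fun i => Φ (z + σ • ξ i) - Φ z) - σ • (fderiv ℝ Φ z).comp (colMatrix ξ)
      - secondOrderMatrix Φ z σ ξ‖ ≤ k * (B * (σ * ‖colMatrix ξ‖) ^ 3) := by
  have heq : colMatrix (fun i => Φ (z + σ • ξ i) - Φ z) - σ • (fderiv ℝ Φ z).comp (colMatrix ξ)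
      - secondOrderMatrix Φ z σ ξ = colMatrix (fun i => Φ (z + σ • ξ i) - Φ z
        - fderiv ℝ Φ z (σ • ξ i)
        - (1 / 2 : ℝ) • iteratedFDeriv ℝ 2 Φ z ![σ • ξ i, σ • ξ i]) := by
    ext1 a
    have hR : ∀ i, iteratedFDeriv ℝ 2 Φ z ![σ • ξ i, σ • ξ i]
        = σ ^ 2 • iteratedFDeriv ℝ 2 Φ z ![ξ i, ξ i] := fun i => by
      simp only [iteratedFDeriv_two_apply, Matrix.cons_val_zero, Matrix.cons_val_one, map_smul,
        _root_.smul_apply, smul_smul, sq]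
    simp only [_root_.sub_apply, _root_.smul_apply,
      ContinuousLinearMap.comp_apply, secondOrderMatrix, colMatrix_apply, map_sum, map_smul,
      Finset.smul_sum, ← Finset.sum_sub_distrib, hR]
    refine Finset.sum_congr rfl fun i _ => ?_
    module
  rw [heq]
  refine norm_colMatrix_le fun i => ?_
  have hle : ‖σ • ξ i‖ ≤ σ * ‖colMatrix ξ‖ := by
    rw [norm_smul, Real.norm_eq_abs, abs_of_pos hσ]
    gcongr
    exact norm_le_norm_colMatrix ξ i
  refine (norm_taylor_two_le hΦ hB (hle.trans_lt hσr)).trans ?_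
  gcongr

/-- The deviation bound with an explicit lower bound of the smallest singular value of the secant
matrix. -/
theorem secantDeviation_le_div (hτ : 0 < τ) (hM : ENNReal.ofReal τ ≤ reach M)
    (hΦ : IsTubeFlow d M κ ρ Φ z r B) (hN : IsNearTangent M κ ρ Φ z σ ξ Lperp Ccurv)
    (hr : 0 < r) (hσ : 0 < σ) (hσr : σ * ‖colMatrix ξ‖ < r) {m : ℝ} (hm : 0 < m)
    (hmle : m ≤ (1 - 2 * ρ / τ) * tangentSignal M Φ z ξ
      - (k * B * σ * ‖colMatrix ξ‖ ^ 2 / 2 + k * B * σ ^ 2 * ‖colMatrix ξ‖ ^ 3)) :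
    secantDeviation M Φ z σ ξ ≤ (Lperp * ρ * ‖colMatrix ξ‖ + Ccurv * κ * σ * ‖colMatrix ξ‖ ^ 2
      + k * B * σ ^ 2 * ‖colMatrix ξ‖ ^ 3) / m := by
  have hz : z ∈ Metric.ball z r := Metric.mem_ball_self hr
  have hB0 : 0 ≤ B := (norm_nonneg _).trans (hΦ.second_deriv_le z hz)
  set X := ‖colMatrix ξ‖ with hX
  have hX0 : 0 ≤ X := norm_nonneg _
  set P := (footTangent M Φ z)ᗮ.starProjection with hP
  set D := fderiv ℝ Φ z with hD
  set R := secondOrderMatrix Φ z σ ξ with hR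
  set V := colMatrix (fun i => Φ (z + σ • ξ i) - Φ z) with hV
  set E := V - σ • D.comp (colMatrix ξ) - R with hE
  have hVa : ∀ a, V a = σ • D (colMatrix ξ a) + R a + E a := fun a => by
    simp only [hE, _root_.sub_apply, _root_.smul_apply,
      ContinuousLinearMap.comp_apply]
    abel
  have hEn : ‖E‖ ≤ k * (B * (σ * X) ^ 3) :=
    norm_secant_sub_taylor_le hΦ.contDiffOn hΦ.third_deriv_le hB0 hσ hσr
  have hRn : ‖R‖ ≤ k * (σ ^ 2 / 2 * (B * X ^ 2)) :=
    norm_secondOrderMatrix_le hσ (hΦ.second_deriv_le z hz)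
  have hPn : ∀ x, ‖P x‖ ≤ ‖x‖ := fun x => Submodule.norm_starProjection_apply_le _ x
  have hL0 : 0 ≤ Lperp * ρ := (norm_nonneg _).trans hN.differential
  have hC0 : 0 ≤ Ccurv * κ * σ ^ 2 * X ^ 2 := (norm_nonneg _).trans hN.second_order
  have hdiff : DifferentiableAt ℝ Φ z :=
    (hΦ.contDiffOn.contDiffAt (Metric.isOpen_ball.mem_nhds hz)).differentiableAt (by norm_num)
  have hDlow : ∀ a, ((1 - 2 * ρ / τ) * tangentSignal M Φ z ξ) * ‖a‖ ≤ ‖D (colMatrix ξ a)‖ := by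
    intro a
    -- The Lipschitz estimate has content only for a positive factor; otherwise the left side is
    -- nonpositive.
    rcases le_or_gt (1 - 2 * ρ / τ) 0 with hc | hc
    · refine le_trans ?_ (norm_nonneg _)
      have : 0 ≤ tangentSignal M Φ z ξ := LinearMap.singularValues_nonneg _ _
      exact mul_nonpos_of_nonpos_of_nonneg (mul_nonpos_of_nonpos_of_nonneg hc this) (norm_nonneg _)
    · have h := mul_norm_fderiv_le (g := footMap M Φ) hdiff (fun w => norm_nearestPoint_sub_le hM hτ
        (hΦ.mapsTo_tube z) (hΦ.mapsTo_tube w) hΦ.radius_pos.le) (colMatrix ξ a)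
      refine le_trans ?_ h
      rw [mul_assoc]
      gcongr
      exact tangentSignal_mul_norm_le a
  have hlow : ∀ a, (σ * m) * ‖a‖ ≤ ‖V a‖ := by
    intro a
    have h1 : ‖σ • D (colMatrix ξ a)‖ ≤ ‖V a‖ + ‖R a‖ + ‖E a‖ := by
      rw [show σ • D (colMatrix ξ a) = V a - R a - E a by rw [hVa]; abel]
      exact (norm_sub_le _ _).trans (by gcongr; exact norm_sub_le _ _)
    rw [norm_smul, Real.norm_eq_abs, abs_of_pos hσ] at h1
    have h2 := R.le_of_opNorm_le hRn a
    have h3 := E.le_of_opNorm_le hEn a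
    have h4 := mul_le_mul_of_nonneg_left (hDlow a) hσ.le
    have h5 := mul_le_mul_of_nonneg_left hmle (mul_nonneg hσ.le (norm_nonneg a))
    linear_combination h1 + h2 + h3 + h4 + h5
  have hup : ∀ a, ‖P (V a)‖ ≤
      (σ * (Lperp * ρ * X + Ccurv * κ * σ * X ^ 2 + k * B * σ ^ 2 * X ^ 3)) * ‖a‖ := by
    intro a
    have h1 : ‖P (V a)‖ ≤ σ * ‖P (D (colMatrix ξ a))‖ + ‖P (R a)‖ + ‖P (E a)‖ := by
      rw [hVa, map_add, map_add, map_smul]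
      refine (norm_add₃_le).trans_eq ?_
      rw [norm_smul, Real.norm_eq_abs, abs_of_pos hσ]
    have h2 : ‖P (D (colMatrix ξ a))‖ ≤ Lperp * ρ * (X * ‖a‖) :=
      ((P.comp D).le_of_opNorm_le hN.differential _).trans
        (mul_le_mul_of_nonneg_left ((colMatrix ξ).le_opNorm a) hL0)
    have h3 : ‖P (R a)‖ ≤ Ccurv * κ * σ ^ 2 * X ^ 2 * ‖a‖ :=
      (P.comp R).le_of_opNorm_le hN.second_order a
    have h4 := (hPn (E a)).trans (E.le_of_opNorm_le hEn a)
    have h5 := mul_le_mul_of_nonneg_left h2 hσ.le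
    linear_combination h1 + h3 + h4 + h5
  -- `Ccurv` itself may be negative; the sign of the product comes from the norm it bounds.
  have hC1 : 0 ≤ Ccurv * κ * σ * X ^ 2 := by
    refine nonneg_of_mul_nonneg_right ?_ hσ
    linear_combination hC0
  have h := norm_comp_starProjection_span_le _ P (mul_pos hσ hm) (by positivity) hlow hup
  rwa [mul_div_mul_left _ _ hσ.ne'] at h

/-- The deviation bound with a multiplicative error `1 + 2 δ`, where `δ` is linear in `ρ` and `σ`. -/
theorem secantDeviation_le_mul (hτ : 0 < τ) (hM : ENNReal.ofReal τ ≤ reach M)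
    (hΦ : IsTubeFlow d M κ ρ Φ z r B) (hN : IsNearTangent M κ ρ Φ z σ ξ Lperp Ccurv)
    (hr : 0 < r) (hσ : 0 < σ) (hσ1 : σ ≤ 1) (hσr : σ * ‖colMatrix ξ‖ < r) (hs₀ : 0 < s₀)
    (hs : s₀ ≤ tangentSignal M Φ z ξ) {δ : ℝ} (hδ : δ ≤ 1 / 2)
    (hδle : 2 / τ * ρ + k * B * (‖colMatrix ξ‖ ^ 2 + ‖colMatrix ξ‖ ^ 3) / s₀ * σ ≤ δ) :
    secantDeviation M Φ z σ ξ ≤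
      (1 + 2 * δ) * (Lperp * ρ * ‖colMatrix ξ‖ / tangentSignal M Φ z ξ
        + Ccurv * κ * σ * ‖colMatrix ξ‖ ^ 2 / tangentSignal M Φ z ξ)
      + 2 * k * B * σ ^ 2 * ‖colMatrix ξ‖ ^ 3 / tangentSignal M Φ z ξ := by
  have hz : z ∈ Metric.ball z r := Metric.mem_ball_self hr
  have hB0 : 0 ≤ B := (norm_nonneg _).trans (hΦ.second_deriv_le z hz)
  set X := ‖colMatrix ξ‖ with hX
  set s := tangentSignal M Φ z ξ with hs'
  have hX0 : 0 ≤ X := norm_nonneg _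
  have hspos : 0 < s := hs₀.trans_le hs
  have hρ := hΦ.radius_pos
  have hδ0 : 0 ≤ δ := le_trans (by positivity) hδle
  -- `σ ≤ 1` absorbs the cubic term, and `s₀ ≤ s` turns the loss into a multiple of `s`.
  have hK : k * B * σ * X ^ 2 / 2 + k * B * σ ^ 2 * X ^ 3
      ≤ k * B * (X ^ 2 + X ^ 3) / s₀ * σ * s := by
    have h1 : k * B * σ * X ^ 2 / 2 + k * B * σ ^ 2 * X ^ 3 ≤ k * B * (X ^ 2 + X ^ 3) * σ := by
      have h2 : 0 ≤ k * B * σ * X ^ 3 := by positivity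
      have h3 : 0 ≤ k * B * σ * X ^ 2 := by positivity
      nlinarith
    refine h1.trans ?_
    rw [div_mul_eq_mul_div, div_mul_eq_mul_div, le_div_iff₀ hs₀]
    gcongr
  have h := secantDeviation_le_div hτ hM hΦ hN hr hσ hσr (m := (1 - δ) * s)
    (mul_pos (by linarith) hspos) (by
      have h1 := mul_le_mul_of_nonneg_right hδle hspos.le
      linear_combination h1 + hK)
  have hL0 : 0 ≤ Lperp * ρ := (norm_nonneg _).trans hN.differential
  have hC0 : 0 ≤ Ccurv * κ * σ ^ 2 * X ^ 2 := (norm_nonneg _).trans hN.second_order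
  have hC1 : 0 ≤ Ccurv * κ * σ * X ^ 2 := by
    refine nonneg_of_mul_nonneg_right ?_ hσ
    linear_combination hC0
  -- `1 / (1 - δ) ≤ 1 + 2δ` for `0 ≤ δ ≤ 1 / 2`. On the remainder term `1 + 2δ ≤ 2`, whence the
  -- constant `2 k B`.
  have hinv : ((1 - δ) * s)⁻¹ ≤ (1 + 2 * δ) * s⁻¹ := by
    rw [mul_inv]
    gcongr
    rw [inv_le_iff_one_le_mul₀ (by linarith)]
    nlinarith
  refine h.trans ?_
  have h3 : 0 ≤ k * B * σ ^ 2 * X ^ 3 := by positivity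
  have h4 := mul_le_mul_of_nonneg_left hinv (add_nonneg (add_nonneg (mul_nonneg hL0 hX0) hC1) h3)
  have h5 : (1 + 2 * δ) * (k * B * σ ^ 2 * X ^ 3 * s⁻¹) ≤ 2 * (k * B * σ ^ 2 * X ^ 3 * s⁻¹) := by
    gcongr
    linarith
  simp only [div_eq_mul_inv] at *
  linear_combination h4 + h5

end Deviation

/-! ### Choice of scales and the main theorem -/

theorem exists_small_scale {r δ : ℝ} (X K : ℝ) (hr : 0 < r) (hδ : 0 < δ) :
    ∃ σ₀ > 0, ∀ σ : ℝ, 0 ≤ σ → σ ≤ σ₀ → σ ≤ 1 ∧ σ * X < r ∧ K * σ ≤ δ := by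
  have h1 : ∀ᶠ σ : ℝ in 𝓝 0, σ < 1 := eventually_lt_nhds one_pos
  have h2 : ∀ᶠ σ : ℝ in 𝓝 0, σ * X < r :=
    (continuous_mul_const X).continuousAt.eventually_lt_const (by simpa using hr)
  have h3 : ∀ᶠ σ : ℝ in 𝓝 0, K * σ < δ :=
    (continuous_const_mul K).continuousAt.eventually_lt_const (by simpa using hδ)
  obtain ⟨e, he, h⟩ := Metric.eventually_nhds_iff.1 (h1.and (h2.and h3))
  refine ⟨e / 2, by positivity, fun σ h0 hσ => ?_⟩
  obtain ⟨a, b, c⟩ := h (y := σ) (by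
    rw [Real.dist_eq, sub_zero, abs_of_nonneg h0]; linarith)
  exact ⟨a.le, b, c.le⟩

/-- The first two terms of the deviation bound are nonnegative and linear in `ρ` and `κ`. -/
theorem main_terms_bounds {n k : ℕ} {M : Set (EuclideanSpace ℝ (Fin n))}
    {Φ : EuclideanSpace ℝ (Fin n) → EuclideanSpace ℝ (Fin n)} {z : EuclideanSpace ℝ (Fin n)}
    {ξ : Fin k → EuclideanSpace ℝ (Fin n)} {κ ρ σ Lperp Ccurv s₀ s : ℝ}
    (hN : IsNearTangent M κ ρ Φ z σ ξ Lperp Ccurv) (hρ : 0 < ρ) (hκ : 0 ≤ κ) (hσ : 0 < σ)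
    (hs₀ : 0 < s₀) (hs : s₀ ≤ s) :
    0 ≤ Lperp * ρ * ‖colMatrix ξ‖ / s + Ccurv * κ * σ * ‖colMatrix ξ‖ ^ 2 / s ∧
    Lperp * ρ * ‖colMatrix ξ‖ / s + Ccurv * κ * σ * ‖colMatrix ξ‖ ^ 2 / s ≤
      (|Lperp| * ρ * ‖colMatrix ξ‖ + |Ccurv| * κ * σ * ‖colMatrix ξ‖ ^ 2) / s := by
  have hspos : 0 < s := hs₀.trans_le hs
  have hL0 : 0 ≤ Lperp * ρ := (norm_nonneg _).trans hN.differential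
  have hC0 : 0 ≤ Ccurv * κ * σ ^ 2 * ‖colMatrix ξ‖ ^ 2 := (norm_nonneg _).trans hN.second_order
  have hC1 : 0 ≤ Ccurv * κ * σ * ‖colMatrix ξ‖ ^ 2 := by
    refine nonneg_of_mul_nonneg_right ?_ hσ
    linear_combination hC0
  refine ⟨by positivity, ?_⟩
  rw [← add_div]
  gcongr <;> exact le_abs_self _

/-- The deviation bound with the constant `2 k B`, for `σ` and `ρ` small independently. -/
theorem exists_secantDeviation_le {n d k : ℕ} {B : ℝ} (ξ : Fin k → EuclideanSpace ℝ (Fin n))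
    {τ r s₀ ε : ℝ} (hτ : 0 < τ) (hr : 0 < r) (hs₀ : 0 < s₀) (hε : 0 < ε) :
    ∃ σ₀ > 0, ∃ ρ₀ > 0, ∀ (M : Set (EuclideanSpace ℝ (Fin n)))
      (Φ : EuclideanSpace ℝ (Fin n) → EuclideanSpace ℝ (Fin n))
      (z : EuclideanSpace ℝ (Fin n)) (κ Lperp Ccurv σ ρ : ℝ),
      0 < σ → σ ≤ σ₀ → ρ ≤ ρ₀ → ENNReal.ofReal τ ≤ reach M → IsTubeFlow d M κ ρ Φ z r B →
      IsNearTangent M κ ρ Φ z σ ξ Lperp Ccurv → s₀ ≤ tangentSignal M Φ z ξ →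
      secantDeviation M Φ z σ ξ ≤
        (1 + ε) * (Lperp * ρ * ‖colMatrix ξ‖ / tangentSignal M Φ z ξ
          + Ccurv * κ * σ * ‖colMatrix ξ‖ ^ 2 / tangentSignal M Φ z ξ)
        + 2 * k * B * σ ^ 2 * ‖colMatrix ξ‖ ^ 3 / tangentSignal M Φ z ξ := by
  set δ := min ε 1 / 2 with hδ
  have hδpos : 0 < δ := by positivity
  have hδ1 : δ ≤ 1 / 2 := by linarith [min_le_right ε 1]
  have hδε : 2 * δ ≤ ε := by linarith [min_le_left ε 1]
  obtain ⟨σ₀, hσ₀, hsmall⟩ := exists_small_scale ‖colMatrix ξ‖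
    (k * B * (‖colMatrix ξ‖ ^ 2 + ‖colMatrix ξ‖ ^ 3) / s₀) hr (half_pos hδpos)
  -- The error `δ` is split evenly: `ρ ≤ δ τ / 4` makes `2 ρ / τ ≤ δ / 2`, and `σ₀` handles the
  -- other half.
  refine ⟨σ₀, hσ₀, δ * τ / 4, by positivity, ?_⟩
  intro M Φ z κ Lperp Ccurv σ ρ hσ hσ₀' hρ₀ hM hΦ hN hs
  obtain ⟨h1, h2, h3⟩ := hsmall σ hσ.le hσ₀'
  have hρδ : 2 / τ * ρ ≤ δ / 2 := by
    rw [div_mul_eq_mul_div, div_le_iff₀ hτ]; linarith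
  refine (secantDeviation_le_mul hτ hM hΦ hN hr hσ h1 h2 hs₀ hs hδ1 (by linarith)).trans ?_
  have := (main_terms_bounds hN hΦ.radius_pos hΦ.curvature.1 hσ hs₀ hs).1
  gcongr

/-- The deviation bound without a multiplicative error, for `ρ = O(σ)`. -/
theorem exists_secantDeviation_le_of_radius_le {n d k : ℕ} (hk : 1 ≤ k) {B : ℝ} (hB : 0 ≤ B)
    (ξ : Fin k → EuclideanSpace ℝ (Fin n)) {τ r s₀ κ Lperp Ccurv Λ : ℝ}
    (hτ : 0 < τ) (hr : 0 < r) (hs₀ : 0 < s₀) (hΛ : 0 < Λ) :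
    ∃ C₃ : ℝ, 0 ≤ C₃ ∧ ∃ σ₀ > 0, ∀ (M : Set (EuclideanSpace ℝ (Fin n)))
      (Φ : EuclideanSpace ℝ (Fin n) → EuclideanSpace ℝ (Fin n))
      (z : EuclideanSpace ℝ (Fin n)) (σ ρ : ℝ),
      0 < σ → σ ≤ σ₀ → ρ ≤ Λ * σ → ENNReal.ofReal τ ≤ reach M → IsTubeFlow d M κ ρ Φ z r B →
      IsNearTangent M κ ρ Φ z σ ξ Lperp Ccurv → s₀ ≤ tangentSignal M Φ z ξ →
      secantDeviation M Φ z σ ξ ≤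
        Lperp * ρ * ‖colMatrix ξ‖ / tangentSignal M Φ z ξ
          + Ccurv * κ * σ * ‖colMatrix ξ‖ ^ 2 / tangentSignal M Φ z ξ
        + C₃ * σ ^ 2 * ‖colMatrix ξ‖ ^ 3 / tangentSignal M Φ z ξ := by
  set X := ‖colMatrix ξ‖ with hX
  have hX0 : 0 ≤ X := norm_nonneg _
  set K := 2 / τ * Λ + k * B * (X ^ 2 + X ^ 3) / s₀ with hK
  have hK0 : 0 ≤ K := by positivity
  set A := |Lperp| * Λ * X + |Ccurv| * |κ| * X ^ 2 with hA
  have hA0 : 0 ≤ A := by positivity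
  obtain ⟨σ₀, hσ₀, hsmall⟩ := exists_small_scale X K hr one_half_pos
  -- With `ρ ≤ Λ σ` the relative error is `2 K σ` and the main terms are at most `A σ / s`. Their
  -- product `2 K A σ² / s` is rewritten as a multiple of `σ² X³ / s`; `X > 0` follows from `s > 0`.
  refine ⟨2 * K * A / X ^ 3 + 2 * k * B, by positivity, σ₀, hσ₀, ?_⟩
  intro M Φ z σ ρ hσ hσ₀' hρΛ hM hΦ hN hs
  obtain ⟨h1, h2, h3⟩ := hsmall σ hσ.le hσ₀'
  have hspos : 0 < tangentSignal M Φ z ξ := hs₀.trans_le hs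
  have hXpos : 0 < X := norm_colMatrix_pos_of_tangentSignal_pos hk hspos
  have hρδ : 2 / τ * ρ ≤ 2 / τ * (Λ * σ) := by gcongr
  have h := secantDeviation_le_mul hτ hM hΦ hN hr hσ h1 h2 hs₀ hs h3 (by
    rw [hK, add_mul]; linarith)
  have hb := (main_terms_bounds hN hΦ.radius_pos hΦ.curvature.1 hσ hs₀ hs).2
  set s := tangentSignal M Φ z ξ
  have hAσ : (|Lperp| * ρ * X + |Ccurv| * κ * σ * X ^ 2) / s ≤ A * σ / s := by
    gcongr
    calc |Lperp| * ρ * X + |Ccurv| * κ * σ * X ^ 2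
        ≤ |Lperp| * (Λ * σ) * X + |Ccurv| * |κ| * σ * X ^ 2 := by
          gcongr
          exact le_abs_self _
      _ = A * σ := by rw [hA]; ring
  have hmul := mul_le_mul_of_nonneg_left (hb.trans hAσ)
    (show 0 ≤ 2 * (K * σ) by positivity)
  have heq : (2 * K * A / X ^ 3 + 2 * k * B) * σ ^ 2 * X ^ 3 / s
      = 2 * (K * σ) * (A * σ / s) + 2 * k * B * σ ^ 2 * X ^ 3 / s := by
    field_simp
  rw [heq]
  linear_combination h + hmul

theorem mainTheorem1 (n d k : ℕ) (hk : 1 ≤ k) (hkd : k ≤ d) (B : ℝ) (hB : 0 ≤ B) :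
    (∃ C₃ : ℝ, 0 ≤ C₃ ∧
      ∀ (ξ : Fin k → EuclideanSpace ℝ (Fin n)) (τ r s₀ : ℝ), 0 < τ → 0 < r → 0 < s₀ →
        -- `σ` and `ρ` small independently of each other
        (∀ ε : ℝ, 0 < ε → ∃ σ₀ > 0, ∃ ρ₀ > 0,
          ∀ (M : Set (EuclideanSpace ℝ (Fin n)))
            (Φ : EuclideanSpace ℝ (Fin n) → EuclideanSpace ℝ (Fin n))
            (z : EuclideanSpace ℝ (Fin n)) (κ Lperp Ccurv σ ρ : ℝ),
            0 < σ → σ ≤ σ₀ → ρ ≤ ρ₀ →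
            ENNReal.ofReal τ ≤ reach M →
            IsTubeFlow d M κ ρ Φ z r B →
            IsNearTangent M κ ρ Φ z σ ξ Lperp Ccurv →
            s₀ ≤ tangentSignal M Φ z ξ →
            secantDeviation M Φ z σ ξ ≤
              (1 + ε) * (Lperp * ρ * ‖colMatrix ξ‖ / tangentSignal M Φ z ξ
                + Ccurv * κ * σ * ‖colMatrix ξ‖ ^ 2 / tangentSignal M Φ z ξ)
              + C₃ * σ ^ 2 * ‖colMatrix ξ‖ ^ 3 / tangentSignal M Φ z ξ) ∧
        -- `ρ, κ → 0` for fixed small `σ`: only the last term remains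
        (∃ σ₀ > 0, ∀ σ Lperp Ccurv η : ℝ, 0 < σ → σ ≤ σ₀ → 0 < η → ∃ δ > 0,
          ∀ (M : Set (EuclideanSpace ℝ (Fin n)))
            (Φ : EuclideanSpace ℝ (Fin n) → EuclideanSpace ℝ (Fin n))
            (z : EuclideanSpace ℝ (Fin n)) (κ ρ : ℝ),
            ρ ≤ δ → κ ≤ δ →
            ENNReal.ofReal τ ≤ reach M →
            IsTubeFlow d M κ ρ Φ z r B →
            IsNearTangent M κ ρ Φ z σ ξ Lperp Ccurv →
            s₀ ≤ tangentSignal M Φ z ξ →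
            secantDeviation M Φ z σ ξ ≤
              C₃ * σ ^ 2 * ‖colMatrix ξ‖ ^ 3 / tangentSignal M Φ z ξ + η)) ∧
    -- smallness of `σ`, with `ρ` at most a fixed multiple of `σ`; `C₃` does not depend on `σ, ρ`
    (∀ (ξ : Fin k → EuclideanSpace ℝ (Fin n)) (τ r s₀ κ Lperp Ccurv Λ : ℝ),
        0 < τ → 0 < r → 0 < s₀ → 0 < Λ →
        ∃ C₃ : ℝ, 0 ≤ C₃ ∧ ∃ σ₀ > 0, ∃ ρ₀ > 0,
          ∀ (M : Set (EuclideanSpace ℝ (Fin n)))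
            (Φ : EuclideanSpace ℝ (Fin n) → EuclideanSpace ℝ (Fin n))
            (z : EuclideanSpace ℝ (Fin n)) (σ ρ : ℝ),
            0 < σ → σ ≤ σ₀ → ρ ≤ ρ₀ → ρ ≤ Λ * σ →
            ENNReal.ofReal τ ≤ reach M →
            IsTubeFlow d M κ ρ Φ z r B →
            IsNearTangent M κ ρ Φ z σ ξ Lperp Ccurv →
            s₀ ≤ tangentSignal M Φ z ξ →
            secantDeviation M Φ z σ ξ ≤
              Lperp * ρ * ‖colMatrix ξ‖ / tangentSignal M Φ z ξ
              + Ccurv * κ * σ * ‖colMatrix ξ‖ ^ 2 / tangentSignal M Φ z ξ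
              + C₃ * σ ^ 2 * ‖colMatrix ξ‖ ^ 3 / tangentSignal M Φ z ξ) ∧
    -- the first two terms vanish as `ρ, κ → 0` for fixed `σ`
    (∀ (ξ : Fin k → EuclideanSpace ℝ (Fin n)) (Lperp Ccurv σ s : ℝ), 0 < σ → 0 < s →
        Tendsto (fun ρ : ℝ => Lperp * ρ * ‖colMatrix ξ‖ / s) (𝓝[>] 0) (𝓝 0) ∧
        Tendsto (fun κ : ℝ => Ccurv * κ * σ * ‖colMatrix ξ‖ ^ 2 / s) (𝓝[≥] 0) (𝓝 0)) := by
  refine ⟨⟨2 * k * B, by positivity, fun ξ τ r s₀ hτ hr hs₀ =>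
    ⟨fun ε hε => exists_secantDeviation_le ξ hτ hr hs₀ hε, ?_⟩⟩, ?_, ?_⟩
  -- Taking `ε = 1` is enough, since the doubled main terms still vanish with `ρ` and `κ`.
  · obtain ⟨σ₀, hσ₀, ρ₀, hρ₀, h⟩ :=
      exists_secantDeviation_le (d := d) (B := B) ξ hτ hr hs₀ one_pos
    refine ⟨σ₀, hσ₀, fun σ Lperp Ccurv η hσ hσle hη => ?_⟩
    set X := ‖colMatrix ξ‖ with hX
    -- Only the last of the three conclusions matters here, so `0` and `one_pos` are placeholders.
    obtain ⟨δ, hδ, hsmall⟩ := exists_small_scale 0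
      (2 * ((|Lperp| * X + |Ccurv| * σ * X ^ 2) / s₀)) one_pos hη
    refine ⟨min δ ρ₀, lt_min hδ hρ₀, fun M Φ z κ ρ hρ hκ hM hΦ hN hs => ?_⟩
    have hdev := h M Φ z κ Lperp Ccurv σ ρ hσ hσle (hρ.trans (min_le_right _ _)) hM hΦ hN hs
    have hb := (main_terms_bounds hN hΦ.radius_pos hΦ.curvature.1 hσ hs₀ hs).2
    obtain ⟨-, -, hKδ⟩ := hsmall δ hδ.le le_rfl
    have hle : (|Lperp| * ρ * X + |Ccurv| * κ * σ * X ^ 2) / tangentSignal M Φ z ξ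
        ≤ (|Lperp| * X + |Ccurv| * σ * X ^ 2) / s₀ * δ := by
      have hρδ := hρ.trans (min_le_left _ _)
      have hκδ := hκ.trans (min_le_left _ _)
      calc _ ≤ (|Lperp| * δ * X + |Ccurv| * δ * σ * X ^ 2) / s₀ := by gcongr
        _ = _ := by ring
    linarith
  · intro ξ τ r s₀ κ Lperp Ccurv Λ hτ hr hs₀ hΛ
    obtain ⟨C₃, hC₃, σ₀, hσ₀, h⟩ := exists_secantDeviation_le_of_radius_le (d := d) hk hB ξ
      (κ := κ) (Lperp := Lperp) (Ccurv := Ccurv) hτ hr hs₀ hΛ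
    -- `ρ₀ = 1` is arbitrary: `ρ ≤ Λ σ` already makes `ρ` small.
    exact ⟨C₃, hC₃, σ₀, hσ₀, 1, one_pos, fun M Φ z σ ρ hσ hσle _ => h M Φ z σ ρ hσ hσle⟩
  · intro ξ Lperp Ccurv σ s _ _
    constructor
    · have : Continuous fun ρ : ℝ => Lperp * ρ * ‖colMatrix ξ‖ / s := by fun_prop
      simpa using (this.tendsto 0).mono_left nhdsWithin_le_nhds
    · have : Continuous fun κ : ℝ => Ccurv * κ * σ * ‖colMatrix ξ‖ ^ 2 / s := by fun_prop
      simpa using (this.tendsto 0).mono_left nhdsWithin_le_nhds
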